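/- Let $X$ be a finite set of indeterminates. A monomial over $X$ is a function $m\colon X\to\mathbb{N}\cup\{\infty\}$ (its exponents); $m$ absorbs $m'$ if $m(x)\le m'(x)$ for all $x\in X$. The semiring $\mathbb{S}^\infty[X]$ consists of all antichains of monomials with respect to absorption ("polynomials"). The sum of two polynomials is their union and the product is the set of all products of a monomial of the first with a monomial of the second (exponents are added), where in both cases only the absorption-dominant monomials are kept; $0$ is the empty antichain and $1$ consists of the monomial with all exponents $0$. With respect to the natural order ($p\le q$ iff $p+r=q$ for some $r$), infinite sums are suprema of finite partial sums and infinite products are infima of finite subproducts. Let $\tau$ be a relational vocabulary and $A,B$ non-empty, possibly infinite, universes. An $\mathbb{S}^\infty[X]$-interpretation $\pi_A$ with universe $A$ maps every literal $R\bar c$ and $\neg R\bar c$ ($R\in\tau$, $\bar c$ in $A$) to an element of $\mathbb{S}^\infty[X]$. It extends to first-order formulae in negation normal form: equalities and inequalities get their truth value $0$ or $1$, $\vee$ and $\exists$ are interpreted as sums, $\wedge$ and $\forall$ as products. In the Ehrenfeucht–Fraïssé game $G_j(\pi_A,\bar a,\pi_B,\bar b)$, in each of $j$ turns Spoiler picks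 an element of $A$ or of $B$ and Duplicator answers with an element of the other universe; the picked pairs are appended to $\bar a$ and $\bar b$. Duplicator wins the play if in the end the map $\bar a\mapsto\bar b$ is a local isomorphism, that is, a well-defined bijection between the entries of the two tuples which preserves the values of all literals over these entries; otherwise Spoiler wins. In $G(\pi_A,\bar a,\pi_B,\bar b)$ Spoiler first chooses a number $j$, and then $G_j(\pi_A,\bar a,\pi_B,\bar b)$ is played. For $Y\subseteq X$, a monomial $m$ $Y$-absorbs $m'$ if $m(x)\le m'(x)$ for all $x\in Y$; $m$ is $Y$-separating for polynomials $p,q$ if it is contained in one of them and is not $Y$-absorbed by any monomial of the other; and $e_Y(m):=\sum_{x\in Y}m(x)$. **Theorem.** Let $\pi_A,\pi_B$ be $\mathbb{S}^\infty[X]$-interpretations with elements $\bar a\in A^n$, $\bar b\in B^n$. (1) Let $k\ge 1$ and $r\in\mathbb{N}$. If there are a formula $\varphi(\bar x)$ of quantifier rank at most $r$ with $\pi_A[\![\varphi(\bar a)]\!]\ne\pi_B[\![\varphi(\bar b)]\!]$, a set $Y\subseteq X$ and a $Y$-separating monomial $m$ for $\pi_A[\![\varphi(\bar a)]\!]$ and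 $\pi_B[\![\varphi(\bar b)]\!]$ with $e_Y(m)<k$, then Spoiler has a winning strategy in $G_{kr}(\pi_A,\bar a,\pi_B,\bar b)$. (2) Consequently $G$ is sound for $\equiv$ on $\mathbb{S}^\infty[X]$: if Duplicator has a winning strategy in $G(\pi_A,\bar a,\pi_B,\bar b)$, then $\pi_A[\![\varphi(\bar a)]\!]=\pi_B[\![\varphi(\bar b)]\!]$ for all first-order formulae $\varphi(\bar x)$. -/

import Mathlib

namespace SemiringEF

/-! ### Monomials and generalised absorptive polynomials -/

/-- A monomial over the indeterminates `X` with exponents in `ℕ ∪ {∞}`, given by its exponent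
function. The product of monomials is the pointwise sum of exponents. -/
abbrev Monomial (X : Type*) : Type _ := X → ℕ∞

/-- `m` absorbs `m'` if the exponents of `m` are at most those of `m'`, for every indeterminate. -/
def Absorbs {X : Type*} (m m' : Monomial X) : Prop := ∀ x, m x ≤ m' x

/-- `m` `Y`-absorbs `m'` if the exponents of `m` are at most those of `m'` on `Y`. -/
def AbsorbsOn {X : Type*} (Y : Finset X) (m m' : Monomial X) : Prop := ∀ x ∈ Y, m x ≤ m' x

/-- `e_Y(m)`, the sum of the exponents of `m` over the indeterminates in `Y`. -/
noncomputable def expSum {X : Type*} (Y : Finset X) (m : Monomial X) : ℕ∞ := ∑ x ∈ Y, m x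

/-- A generalised absorptive polynomial: an antichain of monomials with respect to absorption.
For finite `X` these are the elements of `𝕊^∞[X]`. -/
@[ext]
structure AbsPoly (X : Type*) where
  /-- the monomials that occur in the polynomial -/
  monomials : Set (Monomial X)
  antichain : IsAntichain Absorbs monomials

namespace AbsPoly

variable {X : Type*}

/-- Keep only the absorption-dominant monomials of a set of monomials. -/
def ofSet (s : Set (Monomial X)) : AbsPoly X where
  monomials := {m | m ∈ s ∧ ∀ m' ∈ s, Absorbs m' m → m' = m}
  antichain := by
    intro a ha b hb hab h
    exact hab (hb.2 a ha.1 h)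

/-- `0` is the empty polynomial. -/
instance : Zero (AbsPoly X) := ⟨ofSet ∅⟩

/-- `1` consists of the monomial all of whose exponents are `0`. -/
instance : One (AbsPoly X) := ⟨ofSet {0}⟩

instance : Add (AbsPoly X) := ⟨fun p q => ofSet (p.monomials ∪ q.monomials)⟩

instance : Mul (AbsPoly X) :=
  ⟨fun p q => ofSet {m | ∃ m₁ ∈ p.monomials, ∃ m₂ ∈ q.monomials, m = m₁ + m₂}⟩

/-- The natural order, see `le_iff_exists_add` below: every monomial of `p` is absorbed by some
monomial of `q`. -/
instance : LE (AbsPoly X) :=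
  ⟨fun p q => ∀ m ∈ p.monomials, ∃ m' ∈ q.monomials, Absorbs m' m⟩

/-- The supremum of a set of polynomials (see the instance `CompleteLattice` below). -/
instance : SupSet (AbsPoly X) := ⟨fun P => ofSet {m | ∃ p ∈ P, m ∈ p.monomials}⟩

/-- All monomials that are absorbed by a monomial of `p`; an auxiliary set, used only to prove
the algebraic laws. -/
def up (p : AbsPoly X) : Set (Monomial X) := {m | ∃ m' ∈ p.monomials, m' ≤ m}

theorem up_injective : Function.Injective (up (X := X)) := by
  have key : ∀ p q : AbsPoly X, up p = up q → p.monomials ⊆ q.monomials := by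
    intro p q h m hm
    have h1 : m ∈ up q := h ▸ ⟨m, hm, le_refl m⟩
    obtain ⟨m', hm', hle⟩ := h1
    have h2 : m' ∈ up p := h.symm ▸ ⟨m', hm', le_refl m'⟩
    obtain ⟨m'', hm'', hle'⟩ := h2
    have h3 : m'' = m := p.antichain.eq hm'' hm (le_trans hle' hle)
    have h4 : m' = m := le_antisymm hle (h3 ▸ hle')
    exact h4 ▸ hm'
  intro p q h
  exact AbsPoly.ext (Set.Subset.antisymm (key p q h) (key q p h.symm))

theorem le_iff_up {p q : AbsPoly X} : p ≤ q ↔ up p ⊆ up q := by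
  constructor
  · rintro h m ⟨m', hm', hle⟩
    obtain ⟨m'', h1, h2⟩ := h m' hm'
    exact ⟨m'', h1, le_trans h2 hle⟩
  · intro h m hm
    exact h ⟨m, hm, le_refl m⟩

instance : PartialOrder (AbsPoly X) where
  le_refl p := le_iff_up.2 (Set.Subset.refl _)
  le_trans p q r h h' := le_iff_up.2 ((le_iff_up.1 h).trans (le_iff_up.1 h'))
  le_antisymm p q h h' :=
    up_injective (Set.Subset.antisymm (le_iff_up.1 h) (le_iff_up.1 h'))

theorem up_mono {p : AbsPoly X} {m m' : Monomial X} (h : m ∈ up p) (hle : m ≤ m') :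
    m' ∈ up p := by
  obtain ⟨n, hn, hl⟩ := h
  exact ⟨n, hn, le_trans hl hle⟩

variable [Finite X]

theorem mem_up_ofSet {s : Set (Monomial X)} {m : Monomial X} :
    m ∈ up (ofSet s) ↔ ∃ m' ∈ s, m' ≤ m := by
  constructor
  · rintro ⟨m', hm', hle⟩
    exact ⟨m', hm'.1, hle⟩
  · rintro ⟨m', hm', hle⟩
    obtain ⟨n, hn, hmin⟩ := exists_minimal_le_of_wellFoundedLT (· ∈ s) m' hm'
    exact ⟨n, ⟨hmin.prop, fun k hk hkn => le_antisymm hkn (hmin.le_of_le hk hkn)⟩,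
      le_trans hn hle⟩

theorem mem_up_zero {m : Monomial X} : m ∈ up (0 : AbsPoly X) ↔ False :=
  mem_up_ofSet.trans (by simp)

theorem mem_up_one {m : Monomial X} : m ∈ up (1 : AbsPoly X) ↔ True :=
  mem_up_ofSet.trans (by simp)

theorem mem_up_add {p q : AbsPoly X} {m : Monomial X} :
    m ∈ up (p + q) ↔ m ∈ up p ∨ m ∈ up q := by
  refine mem_up_ofSet.trans ?_
  constructor
  · rintro ⟨m', h | h, hle⟩
    · exact Or.inl ⟨m', h, hle⟩
    · exact Or.inr ⟨m', h, hle⟩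
  · rintro (⟨m', h, hle⟩ | ⟨m', h, hle⟩)
    · exact ⟨m', Or.inl h, hle⟩
    · exact ⟨m', Or.inr h, hle⟩

theorem mem_up_mul {p q : AbsPoly X} {m : Monomial X} :
    m ∈ up (p * q) ↔ ∃ m₁ ∈ up p, ∃ m₂ ∈ up q, m₁ + m₂ ≤ m := by
  refine mem_up_ofSet.trans ?_
  constructor
  · rintro ⟨_, ⟨m₁, h₁, m₂, h₂, rfl⟩, hle⟩
    exact ⟨m₁, ⟨m₁, h₁, le_refl _⟩, m₂, ⟨m₂, h₂, le_refl _⟩, hle⟩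
  · rintro ⟨m₁, ⟨n₁, h₁, l₁⟩, m₂, ⟨n₂, h₂, l₂⟩, hle⟩
    exact ⟨n₁ + n₂, ⟨n₁, h₁, n₂, h₂, rfl⟩, le_trans (add_le_add l₁ l₂) hle⟩

protected theorem mul_comm' (p q : AbsPoly X) : p * q = q * p := by
  apply up_injective
  ext m
  rw [mem_up_mul, mem_up_mul]
  constructor <;>
  · rintro ⟨m₁, h₁, m₂, h₂, h⟩
    exact ⟨m₂, h₂, m₁, h₁, by rwa [add_comm]⟩

protected theorem mul_assoc' (p q r : AbsPoly X) : p * q * r = p * (q * r) := by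
  apply up_injective
  ext m
  simp only [mem_up_mul]
  constructor
  · rintro ⟨m₁, ⟨a, ha, b, hb, hab⟩, c, hc, h⟩
    exact ⟨a, ha, b + c, ⟨b, hb, c, hc, le_refl _⟩,
      le_trans (by rw [← add_assoc]; gcongr) h⟩
  · rintro ⟨a, ha, m₁, ⟨b, hb, c, hc, hbc⟩, h⟩
    exact ⟨a + b, ⟨a, ha, b, hb, le_refl _⟩, c, hc,
      le_trans (by rw [add_assoc]; gcongr) h⟩

protected theorem one_mul' (p : AbsPoly X) : 1 * p = p := by
  apply up_injective
  ext m
  simp only [mem_up_mul, mem_up_one]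
  constructor
  · rintro ⟨m₁, -, m₂, h₂, h⟩
    exact up_mono h₂ (le_trans le_add_self h)
  · intro h
    exact ⟨0, trivial, m, h, by simp⟩

protected theorem zero_mul' (p : AbsPoly X) : 0 * p = 0 := by
  apply up_injective
  ext m
  simp [mem_up_mul, mem_up_zero]

protected theorem left_distrib' (p q r : AbsPoly X) : p * (q + r) = p * q + p * r := by
  apply up_injective
  ext m
  simp only [mem_up_mul, mem_up_add]
  constructor
  · rintro ⟨m₁, h₁, m₂, h₂ | h₂, h⟩
    · exact Or.inl ⟨m₁, h₁, m₂, h₂, h⟩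
    · exact Or.inr ⟨m₁, h₁, m₂, h₂, h⟩
  · rintro (⟨m₁, h₁, m₂, h₂, h⟩ | ⟨m₁, h₁, m₂, h₂, h⟩)
    · exact ⟨m₁, h₁, m₂, Or.inl h₂, h⟩
    · exact ⟨m₁, h₁, m₂, Or.inr h₂, h⟩

/-- The commutative semiring `𝕊^∞[X]` of generalised absorptive polynomials. -/
instance : CommSemiring (AbsPoly X) where
  add_assoc p q r := up_injective (by ext m; simp only [mem_up_add]; tauto)
  zero_add p := up_injective (by ext m; simp only [mem_up_add, mem_up_zero]; tauto)
  add_zero p := up_injective (by ext m; simp only [mem_up_add, mem_up_zero]; tauto)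
  add_comm p q := up_injective (by ext m; simp only [mem_up_add]; tauto)
  mul_assoc := AbsPoly.mul_assoc'
  mul_comm := AbsPoly.mul_comm'
  one_mul := AbsPoly.one_mul'
  mul_one p := (AbsPoly.mul_comm' p 1).trans (AbsPoly.one_mul' p)
  zero_mul := AbsPoly.zero_mul'
  mul_zero p := (AbsPoly.mul_comm' p 0).trans (AbsPoly.zero_mul' p)
  left_distrib := AbsPoly.left_distrib'
  right_distrib p q r := by
    rw [AbsPoly.mul_comm' (p + q) r, AbsPoly.left_distrib', AbsPoly.mul_comm' r p,
      AbsPoly.mul_comm' r q]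
  nsmul := nsmulRec
  npow := npowRec

/-- The order on `𝕊^∞[X]` is the natural order of the semiring. -/
theorem le_iff_exists_add {p q : AbsPoly X} : p ≤ q ↔ ∃ r, p + r = q := by
  constructor
  · intro h
    refine ⟨q, up_injective ?_⟩
    ext m
    rw [mem_up_add]
    exact ⟨fun h' => h'.elim (fun h'' => le_iff_up.1 h h'') id, Or.inr⟩
  · rintro ⟨r, rfl⟩
    exact le_iff_up.2 fun m hm => mem_up_add.2 (Or.inl hm)

/-- `𝕊^∞[X]` is absorptive. -/
theorem add_mul_absorb (p q : AbsPoly X) : p + p * q = p := by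
  apply up_injective
  ext m
  simp only [mem_up_add, mem_up_mul]
  constructor
  · rintro (h | ⟨m₁, h₁, m₂, -, h⟩)
    · exact h
    · exact up_mono h₁ (le_trans le_self_add h)
  · exact Or.inl

theorem isLUB_sSup' (P : Set (AbsPoly X)) : IsLUB P (sSup P) := by
  constructor
  · intro p hp
    rw [le_iff_up]
    rintro m ⟨m', hm', hle⟩
    exact mem_up_ofSet.2 ⟨m', ⟨p, hp, hm'⟩, hle⟩
  · intro q hq
    rw [le_iff_up]
    intro m hm
    obtain ⟨m', ⟨p, hp, hm'⟩, hle⟩ := mem_up_ofSet.1 hm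
    exact le_iff_up.1 (hq hp) ⟨m', hm', hle⟩

/-- All suprema and infima exist with respect to the natural order of `𝕊^∞[X]`. -/
noncomputable instance : CompleteLattice (AbsPoly X) := completeLatticeOfSup _ isLUB_sSup'

end AbsPoly

/-- The monomial `m` is contained in one of the polynomials `p`, `q`, but not `Y`-absorbed by any
monomial of the other one. -/
def YSeparates {X : Type*} (Y : Finset X) (m : Monomial X) (p q : AbsPoly X) : Prop :=
  (m ∈ p.monomials ∧ ∀ m' ∈ q.monomials, ¬ AbsorbsOn Y m' m) ∨
  (m ∈ q.monomials ∧ ∀ m' ∈ p.monomials, ¬ AbsorbsOn Y m' m)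

/-! ### Infinitary sums and products -/

/-- Sum of an arbitrary family: the supremum of its finite partial sums. -/
def famSum {S I : Type*} [CommSemiring S] [CompleteLattice S] (f : I → S) : S :=
  ⨆ F : Finset I, ∑ i ∈ F, f i

/-- Product of an arbitrary family in an absorptive semiring: the infimum of its finite
subproducts. -/
def famProd {S I : Type*} [CommSemiring S] [CompleteLattice S] (f : I → S) : S :=
  ⨅ F : Finset I, ∏ i ∈ F, f i

/-! ### Literals, interpretations, formulae in negation normal form -/

/-- Relational literals `R x̄` and `¬ R x̄` with entries of `x̄` in `V`. -/
inductive Lit (L : FirstOrder.Language) (V : Type*) where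
  | pos {k : ℕ} (R : L.Relations k) (x : Fin k → V)
  | neg {k : ℕ} (R : L.Relations k) (x : Fin k → V)

/-- Replace every entry `v` of a literal by `f v`. -/
def Lit.map {L : FirstOrder.Language} {V W : Type*} (f : V → W) : Lit L V → Lit L W
  | .pos R x => .pos R (f ∘ x)
  | .neg R x => .neg R (f ∘ x)

/-- An `S`-interpretation of vocabulary `L` and universe `A`. -/
abbrev Interp (L : FirstOrder.Language) (A S : Type*) : Type _ := Lit L A → S

/-- First-order formulae over `L` in negation normal form, with free variables among
`x_0, …, x_{n-1}`. A quantifier binds the variable `x_n` of a formula in `n + 1` variables. -/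
inductive Formula (L : FirstOrder.Language) : ℕ → Type _ where
  | lit {n : ℕ} (l : Lit L (Fin n)) : Formula L n
  | eq {n : ℕ} (i j : Fin n) : Formula L n
  | ne {n : ℕ} (i j : Fin n) : Formula L n
  | or {n : ℕ} (φ ψ : Formula L n) : Formula L n
  | and {n : ℕ} (φ ψ : Formula L n) : Formula L n
  | ex {n : ℕ} (φ : Formula L (n + 1)) : Formula L n
  | all {n : ℕ} (φ : Formula L (n + 1)) : Formula L n

/-- Quantifier rank. -/
def Formula.qr {L : FirstOrder.Language} : {n : ℕ} → Formula L n → ℕ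
  | _, .lit _ => 0
  | _, .eq _ _ => 0
  | _, .ne _ _ => 0
  | _, .or φ ψ => max φ.qr ψ.qr
  | _, .and φ ψ => max φ.qr ψ.qr
  | _, .ex φ => φ.qr + 1
  | _, .all φ => φ.qr + 1

open Classical in
/-- The semiring semantics `π⟦φ(ā)⟧`. -/
noncomputable def Formula.eval {L : FirstOrder.Language} {A S : Type*} [CommSemiring S]
    [CompleteLattice S] (π : Interp L A S) : {n : ℕ} → Formula L n → (Fin n → A) → S
  | _, .lit l, a => π (l.map a)
  | _, .eq i j, a => if a i = a j then 1 else 0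
  | _, .ne i j, a => if a i = a j then 0 else 1
  | _, .or φ ψ, a => φ.eval π a + ψ.eval π a
  | _, .and φ ψ, a => φ.eval π a * ψ.eval π a
  | _, .ex φ, a => famSum fun c : A => φ.eval π (Fin.snoc a c)
  | _, .all φ, a => famProd fun c : A => φ.eval π (Fin.snoc a c)

/-- Elementary equivalence `(π_A, ā) ≡ (π_B, b̄)`. -/
def ElemEquiv {L : FirstOrder.Language} {A B S : Type*} [CommSemiring S] [CompleteLattice S]
    (πA : Interp L A S) (πB : Interp L B S) {n : ℕ} (a : Fin n → A) (b : Fin n → B) : Prop :=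
  ∀ φ : Formula L n, φ.eval πA a = φ.eval πB b

/-! ### Local isomorphisms and Ehrenfeucht–Fraïssé games -/

/-- The subinterpretation on the literals instantiated with elements of `s`. -/
def Interp.restrict {L : FirstOrder.Language} {A S : Type*} (π : Interp L A S) (s : Set A) :
    Interp L s S :=
  fun l => π (l.map Subtype.val)

/-- `a_i ↦ b_i` is a local isomorphism between `πA` and `πB`: a well-defined bijection between
the entries of `a` and those of `b` that is an isomorphism of the subinterpretations. -/
def LocalIso {L : FirstOrder.Language} {A B S : Type*} (πA : Interp L A S) (πB : Interp L B S)
    {n : ℕ} (a : Fin n → A) (b : Fin n → B) : Prop :=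
  ∃ σ : Set.range a ≃ Set.range b,
    (∀ i, σ ⟨a i, Set.mem_range_self i⟩ = ⟨b i, Set.mem_range_self i⟩) ∧
    ∀ l : Lit L (Set.range a), πA.restrict (Set.range a) l = πB.restrict (Set.range b) (l.map σ)

/-- Spoiler has a winning strategy in the game `G_j(πA, ā, πB, b̄)` with `j` remaining turns: in
each turn he picks an element of `A` or of `B` and Duplicator answers in the other universe; in
the end Spoiler wins iff `ā ↦ b̄` is not a local isomorphism. -/
def SpoilerWins {L : FirstOrder.Language} {A B S : Type*} (πA : Interp L A S)
    (πB : Interp L B S) : ℕ → {n : ℕ} → (Fin n → A) → (Fin n → B) → Prop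
  | 0, _, a, b => ¬ LocalIso πA πB a b
  | j + 1, n, a, b =>
    (∃ c : A, ∀ d : B, SpoilerWins πA πB j (n := n + 1) (Fin.snoc a c) (Fin.snoc b d)) ∨
    (∃ d : B, ∀ c : A, SpoilerWins πA πB j (n := n + 1) (Fin.snoc a c) (Fin.snoc b d))

/-- Duplicator has a winning strategy in the game `G_j(πA, ā, πB, b̄)`. -/
def DuplicatorWins {L : FirstOrder.Language} {A B S : Type*} (πA : Interp L A S)
    (πB : Interp L B S) : ℕ → {n : ℕ} → (Fin n → A) → (Fin n → B) → Prop
  | 0, _, a, b => LocalIso πA πB a b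
  | j + 1, n, a, b =>
    (∀ c : A, ∃ d : B, DuplicatorWins πA πB j (n := n + 1) (Fin.snoc a c) (Fin.snoc b d)) ∧
    (∀ d : B, ∃ c : A, DuplicatorWins πA πB j (n := n + 1) (Fin.snoc a c) (Fin.snoc b d))

/-- Duplicator has a winning strategy in the game `G(πA, ā, πB, b̄)`, in which Spoiler first
chooses a number `j` and then `G_j(πA, ā, πB, b̄)` is played. -/
def DuplicatorWinsG {L : FirstOrder.Language} {A B S : Type*} (πA : Interp L A S)
    (πB : Interp L B S) {n : ℕ} (a : Fin n → A) (b : Fin n → B) : Prop :=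
  ∀ j : ℕ, DuplicatorWins πA πB j a b

end SemiringEF

/-! Replace a polynomial by its upward closure `up` under absorption. Finite and infinite sums
become unions, a finite product contains the monomials above a sum of one monomial from each factor,
and an infinite product is the intersection of its finite subproducts. Raising the exponents of `m`
outside `Y` to `∞` turns `Y`-absorption into membership of `m.topOff Y` in `up`.

`spoilerWins_of_mem_up` is an induction on the formula: if `m.topOff Y` lies in the value on `A` but
not in that on `B`, Spoiler wins. Disjunctions and `∃` pass `m` on; conjunctions and `∀` split it
into parts of no larger `Y`-weight, one of which must be missing on `B`.

The crux is `∀`, where a product may have infinitely many factors. By `exists_small_subproduct`, `m`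
is already missing from a subproduct of at most `k` factors: in a minimal such subproduct every
factor costs `Y`-weight at least 1, and deleting any one factor makes `m` present. Spoiler picks the
elements of `B` indexing these factors, so each quantifier costs at most `k` turns.

Soundness follows because distinct polynomials always have a separating monomial of finite weight
for a suitable `Y`. -/

namespace SemiringEF

/-! ### Upward closures of infinitary sums and products -/

namespace AbsPoly

variable {X : Type*} [Finite X]

/-- Infima are only known through their universal property, so membership is expressed by the order.
-/
theorem mem_up_iff_ofSet_le {p : AbsPoly X} {m : Monomial X} : m ∈ up p ↔ ofSet {m} ≤ p := by
  rw [le_iff_up]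
  constructor
  · intro h m' hm'
    obtain ⟨m'', rfl, hle⟩ := mem_up_ofSet.1 hm'
    exact up_mono h hle
  · intro h
    exact h (mem_up_ofSet.2 ⟨m, rfl, le_rfl⟩)

theorem mem_up_iInf {I : Sort*} {f : I → AbsPoly X} {m : Monomial X} :
    m ∈ up (⨅ i, f i) ↔ ∀ i, m ∈ up (f i) := by
  simp only [mem_up_iff_ofSet_le, le_iInf_iff]

theorem mem_up_iSup {I : Sort*} {f : I → AbsPoly X} {m : Monomial X} :
    m ∈ up (⨆ i, f i) ↔ ∃ i, m ∈ up (f i) := by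
  constructor
  · intro h
    obtain ⟨m', ⟨p, ⟨i, rfl⟩, hp⟩, hle⟩ := mem_up_ofSet.1 h
    exact ⟨i, m', hp, hle⟩
  · rintro ⟨i, h⟩
    exact le_iff_up.1 (le_iSup f i) h

theorem mem_up_sum {I : Type*} {s : Finset I} {f : I → AbsPoly X} {m : Monomial X} :
    m ∈ up (∑ i ∈ s, f i) ↔ ∃ i ∈ s, m ∈ up (f i) := by
  classical
  induction s using Finset.induction_on with
  | empty => simpa using mem_up_zero.1
  | insert i s hi ih =>
    rw [Finset.sum_insert hi]
    refine mem_up_add.trans ?_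
    simp [ih]

theorem mem_up_famSum {I : Type*} {f : I → AbsPoly X} {m : Monomial X} :
    m ∈ up (famSum f) ↔ ∃ i, m ∈ up (f i) := by
  simp only [famSum, mem_up_iSup, mem_up_sum]
  exact ⟨fun ⟨_, i, _, h⟩ => ⟨i, h⟩, fun ⟨i, h⟩ => ⟨{i}, i, Finset.mem_singleton_self i, h⟩⟩

theorem mem_up_prod {I : Type*} {s : Finset I} {f : I → AbsPoly X} {m : Monomial X} :
    m ∈ up (∏ i ∈ s, f i) ↔
      ∃ u : I → Monomial X, (∀ i ∈ s, u i ∈ up (f i)) ∧ ∑ i ∈ s, u i ≤ m := by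
  classical
  induction s using Finset.induction_on generalizing m with
  | empty =>
    simp only [Finset.prod_empty, Finset.notMem_empty, Finset.sum_empty]
    exact ⟨fun _ => ⟨0, by simp, zero_le⟩, fun _ => mem_up_one.2 trivial⟩
  | insert i s hi ih =>
    rw [Finset.prod_insert hi]
    refine mem_up_mul.trans ?_
    constructor
    · rintro ⟨m₁, h₁, m₂, h₂, h⟩
      obtain ⟨u, hu, hle⟩ := ih.1 h₂
      have hne : ∀ j ∈ s, Function.update u i m₁ j = u j := fun j hj =>
        Function.update_of_ne (by rintro rfl; exact hi hj) _ _
      refine ⟨Function.update u i m₁, fun j hj => ?_, ?_⟩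
      · rcases Finset.mem_insert.1 hj with rfl | hj
        · simpa using h₁
        · rw [hne j hj]
          exact hu j hj
      · rw [Finset.sum_insert hi, Finset.sum_congr rfl hne, Function.update_self]
        exact le_trans (add_le_add le_rfl hle) h
    · rintro ⟨u, hu, hle⟩
      rw [Finset.sum_insert hi] at hle
      exact ⟨u i, hu i (Finset.mem_insert_self i s), ∑ j ∈ s, u j,
        ih.2 ⟨u, fun j hj => hu j (Finset.mem_insert_of_mem hj), le_rfl⟩, hle⟩

theorem mem_up_famProd {I : Type*} {f : I → AbsPoly X} {m : Monomial X} :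
    m ∈ up (famProd f) ↔ ∀ s : Finset I, m ∈ up (∏ i ∈ s, f i) :=
  mem_up_iInf

end AbsPoly

/-! ### Monomials relative to a set of indeterminates -/

section Monomial

variable {X : Type*}

open Classical in
/-- Raise all exponents outside `Y` to `∞`. -/
noncomputable def Monomial.topOff (Y : Finset X) (m : Monomial X) : Monomial X :=
  fun x => if x ∈ Y then m x else ⊤

theorem Monomial.le_topOff_iff {Y : Finset X} {m m' : Monomial X} :
    m' ≤ m.topOff Y ↔ AbsorbsOn Y m' m := by
  constructor
  · intro h x hx
    simpa [topOff, hx] using h x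
  · intro h x
    by_cases hx : x ∈ Y
    · simpa [topOff, hx] using h x hx
    · simp [topOff, hx]

/-- This is the dictionary between `YSeparates` and `up`; an exponent `∞` outside `Y` imposes no
condition. -/
theorem Monomial.mem_up_topOff {Y : Finset X} {m : Monomial X} {p : AbsPoly X} :
    m.topOff Y ∈ p.up ↔ ∃ m' ∈ p.monomials, AbsorbsOn Y m' m := by
  simp only [AbsPoly.up, Set.mem_ofPred_eq, le_topOff_iff]

theorem YSeparates.symm {Y : Finset X} {m : Monomial X} {p q : AbsPoly X} (h : YSeparates Y m p q) :
    YSeparates Y m q p :=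
  Or.symm h

theorem expSum_mono {Y : Finset X} {m m' : Monomial X} (h : AbsorbsOn Y m m') :
    expSum Y m ≤ expSum Y m' :=
  Finset.sum_le_sum h

theorem Monomial.absorbsOn_topOff {Y : Finset X} {m : Monomial X} :
    AbsorbsOn Y (m.topOff Y) m :=
  le_topOff_iff.1 le_rfl

theorem Monomial.le_topOff (Y : Finset X) (m : Monomial X) : m ≤ m.topOff Y :=
  le_topOff_iff.2 fun _ _ => le_rfl

theorem expSum_sum {I : Type*} {s : Finset I} {Y : Finset X} {u : I → Monomial X} :
    expSum Y (∑ i ∈ s, u i) = ∑ i ∈ s, expSum Y (u i) := by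
  simp only [expSum, Finset.sum_apply]
  exact Finset.sum_comm

theorem absorbsOn_zero_of_expSum_eq_zero {Y : Finset X} {m : Monomial X} (h : expSum Y m = 0) :
    AbsorbsOn Y m 0 := by
  intro x hx
  exact le_of_eq (Finset.sum_eq_zero_iff.1 h x hx)

/-- If `m` is missing from an infinite product, up to exponents outside `Y`, then it is already
missing from a subproduct of at most `k` factors, for every bound `k` on `e_Y(m)`. -/
theorem exists_small_subproduct [Finite X] {I : Type*} {f : I → AbsPoly X} {Y : Finset X}
    {m : Monomial X} {k : ℕ} (hk : expSum Y m < k) (hm : m.topOff Y ∉ (famProd f).up) :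
    ∃ s : Finset I, s.card ≤ k ∧ m.topOff Y ∉ (∏ i ∈ s, f i).up := by
  classical
  rw [AbsPoly.mem_up_famProd] at hm
  push Not at hm
  obtain ⟨s, hs, hmin⟩ :=
    exists_minimal_of_wellFoundedLT (fun s : Finset I => m.topOff Y ∉ (∏ i ∈ s, f i).up) hm
  refine ⟨s, ?_, hs⟩
  have herase : ∀ i ∈ s, m.topOff Y ∈ (∏ j ∈ s.erase i, f j).up := by
    intro i hi
    by_contra h
    exact Finset.notMem_erase i s (hmin h (Finset.erase_subset i s) hi)
  -- A factor containing a monomial of `Y`-weight 0 could be dropped for free, against minimality.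
  have hbad : ∀ i ∈ s, Monomial.topOff Y 0 ∉ (f i).up := by
    intro i hi h
    apply hs
    rw [← Finset.mul_prod_erase s f hi]
    refine AbsPoly.mem_up_mul.2 ⟨_, h, _, herase i hi, fun x => ?_⟩
    by_cases hx : x ∈ Y <;> simp [Monomial.topOff, hx]
  by_contra! hcard
  -- After deletion of `i`, the other `s.card - 1 ≥ k` factors split `m` into parts of weight at
  -- least 1, too many for `expSum Y m < k`.
  obtain ⟨i, hi⟩ := Finset.card_pos.1 (by omega : 0 < s.card)
  obtain ⟨u, hu, hle⟩ := AbsPoly.mem_up_prod.1 (herase i hi)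
  have h1 : ∀ j ∈ s.erase i, 1 ≤ expSum Y (u j) := by
    intro j hj
    rw [Order.one_le_iff_ne_zero]
    intro h0
    exact hbad j (Finset.mem_of_mem_erase hj) (AbsPoly.up_mono (hu j hj)
      (Monomial.le_topOff_iff.2 (absorbsOn_zero_of_expSum_eq_zero h0)))
  have h2 := expSum_mono (Monomial.le_topOff_iff.1 hle)
  rw [expSum_sum] at h2
  have h3 := Finset.sum_le_sum h1
  rw [Finset.sum_const, Finset.card_erase_of_mem hi, nsmul_one] at h3
  have h4 : (k : ℕ∞) ≤ ((s.card - 1 : ℕ) : ℕ∞) := by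
    exact_mod_cast (by omega : k ≤ s.card - 1)
  exact absurd hk (not_lt.2 (h4.trans (h3.trans h2)))

end Monomial

/-! ### Local isomorphisms and games -/

section Game

variable {L : FirstOrder.Language} {A B S : Type*} {πA : Interp L A S} {πB : Interp L B S}

theorem Lit.map_map {V W U : Type*} (g : W → U) (f : V → W) (l : Lit L V) :
    (l.map f).map g = l.map (g ∘ f) := by
  cases l <;> rfl

/-- Literals over the entries lift to literals over positions by choosing a position for each entry;
equal equality patterns make the choice irrelevant. -/
theorem localIso_iff {n : ℕ} {a : Fin n → A} {b : Fin n → B} :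
    LocalIso πA πB a b ↔ (∀ i j, a i = a j ↔ b i = b j) ∧
      ∀ l : Lit L (Fin n), πA (l.map a) = πB (l.map b) := by
  constructor
  · rintro ⟨σ, hσ, hl⟩
    refine ⟨fun i j => ?_, fun l => ?_⟩
    · have h : (⟨a i, Set.mem_range_self i⟩ : Set.range a) = ⟨a j, Set.mem_range_self j⟩ ↔
          (⟨b i, Set.mem_range_self i⟩ : Set.range b) = ⟨b j, Set.mem_range_self j⟩ := by
        rw [← hσ, ← hσ, σ.apply_eq_iff_eq]
      simpa using h
    · have h := hl (l.map (Set.rangeFactorization a))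
      simp only [Interp.restrict, Lit.map_map] at h
      have hb : Subtype.val ∘ σ ∘ Set.rangeFactorization a = b := by
        funext i
        exact congrArg Subtype.val (hσ i)
      rw [hb] at h
      exact h
  · rintro ⟨heq, hl⟩
    have hs : ∀ x : Set.range a, ∃ i, a i = x := fun x => x.2
    have ht : ∀ y : Set.range b, ∃ i, b i = y := fun y => y.2
    choose s hs using hs
    choose t ht using ht
    refine ⟨⟨fun x => ⟨b (s x), Set.mem_range_self _⟩, fun y => ⟨a (t y), Set.mem_range_self _⟩,
      fun x => ?_, fun y => ?_⟩, fun i => ?_, fun l => ?_⟩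
    · apply Subtype.ext
      rw [← hs x]
      exact (heq _ _).2 (ht _)
    · apply Subtype.ext
      rw [← ht y]
      exact (heq _ _).1 (hs _)
    · apply Subtype.ext
      exact (heq _ _).1 (hs _)
    · have h := hl (l.map s)
      simp only [Lit.map_map] at h
      have ha : a ∘ s = Subtype.val := funext hs
      rw [ha] at h
      simp only [Interp.restrict, Lit.map_map]
      exact h

theorem LocalIso.symm {n : ℕ} {a : Fin n → A} {b : Fin n → B} (h : LocalIso πA πB a b) :
    LocalIso πB πA b a := by
  rw [localIso_iff] at h ⊢
  exact ⟨fun i j => (h.1 i j).symm, fun l => (h.2 l).symm⟩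

theorem LocalIso.comp {n n' : ℕ} {a : Fin n → A} {b : Fin n → B} (h : LocalIso πA πB a b)
    (ρ : Fin n' → Fin n) : LocalIso πA πB (a ∘ ρ) (b ∘ ρ) := by
  rw [localIso_iff] at h ⊢
  refine ⟨fun i j => h.1 (ρ i) (ρ j), fun l => ?_⟩
  rw [← Lit.map_map, ← Lit.map_map]
  exact h.2 _

theorem SpoilerWins.symm {j n : ℕ} {a : Fin n → A} {b : Fin n → B}
    (h : SpoilerWins πA πB j a b) : SpoilerWins πB πA j b a := by
  induction j generalizing n with
  | zero => exact fun h' => h h'.symm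
  | succ j ih =>
    rcases h with ⟨c, hc⟩ | ⟨d, hd⟩
    · exact Or.inr ⟨c, fun d => ih (hc d)⟩
    · exact Or.inl ⟨d, fun c => ih (hd c)⟩

theorem snoc_comp_lift {C : Type*} {n n' : ℕ} (a : Fin n → C) (ρ : Fin n' → Fin n) (c : C) :
    (Fin.snoc (a ∘ ρ) c : Fin (n' + 1) → C) =
      (Fin.snoc a c : Fin (n + 1) → C) ∘
        (Fin.snoc (Fin.castSucc ∘ ρ) (Fin.last n) : Fin (n' + 1) → Fin (n + 1)) := by
  funext i
  refine Fin.lastCases ?_ (fun i => ?_) i <;> simp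

/-- Additional pebbles do not harm Spoiler. -/
theorem SpoilerWins.of_comp {j n n' : ℕ} {a : Fin n → A} {b : Fin n → B} (ρ : Fin n' → Fin n)
    (h : SpoilerWins πA πB j (a ∘ ρ) (b ∘ ρ)) : SpoilerWins πA πB j a b := by
  induction j generalizing n n' with
  | zero => exact fun h' => h (h'.comp ρ)
  | succ j ih =>
    rcases h with ⟨c, hc⟩ | ⟨d, hd⟩
    · refine Or.inl ⟨c, fun d => ?_⟩
      have := hc d
      rw [snoc_comp_lift a, snoc_comp_lift b] at this
      exact ih _ this
    · refine Or.inr ⟨d, fun c => ?_⟩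
      have := hd c
      rw [snoc_comp_lift a, snoc_comp_lift b] at this
      exact ih _ this

theorem snoc_comp_castSucc {C : Type*} {n : ℕ} (a : Fin n → C) (c : C) :
    (Fin.snoc a c : Fin (n + 1) → C) ∘ Fin.castSucc = a := by
  funext i
  simp

theorem SpoilerWins.mono [Nonempty A] {j j' n : ℕ} (hj : j ≤ j') {a : Fin n → A} {b : Fin n → B}
    (h : SpoilerWins πA πB j a b) : SpoilerWins πA πB j' a b := by
  induction hj generalizing n with
  | refl => exact h
  | step _ ih =>
    -- A superfluous turn is wasted on an arbitrary element, whose pebble is then ignored.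
    refine Or.inl ⟨Classical.arbitrary A, fun d => SpoilerWins.of_comp Fin.castSucc ?_⟩
    rw [snoc_comp_castSucc, snoc_comp_castSucc]
    exact ih h

theorem SpoilerWins.of_not_localIso [Nonempty A] {j n : ℕ} {a : Fin n → A} {b : Fin n → B}
    (h : ¬ LocalIso πA πB a b) : SpoilerWins πA πB j a b :=
  SpoilerWins.mono (Nat.zero_le j) (j := 0) h

/-- Spoiler may pick all elements of a finite subset of `B` in succession. -/
theorem SpoilerWins.of_pick_finset (s : Finset B) {j n : ℕ} {a : Fin n → A} {b : Fin n → B}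
    (h : ∀ (n' : ℕ) (a' : Fin n' → A) (b' : Fin n' → B) (ρ : Fin n → Fin n'),
      a' ∘ ρ = a → b' ∘ ρ = b → (∀ d ∈ s, ∃ i, b' i = d) → SpoilerWins πA πB j a' b') :
    SpoilerWins πA πB (s.card + j) a b := by
  classical
  induction s using Finset.induction_on generalizing n with
  | empty => simpa using h n a b id rfl rfl (by simp)
  | insert d s hd ih =>
    rw [Finset.card_insert_of_notMem hd, Nat.add_right_comm]
    refine Or.inr ⟨d, fun c => ih fun n' a' b' ρ ha hb hs => ?_⟩
    refine h n' a' b' (ρ ∘ Fin.castSucc) ?_ ?_ fun e he => ?_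
    · rw [← Function.comp_assoc, ha, snoc_comp_castSucc]
    · rw [← Function.comp_assoc, hb, snoc_comp_castSucc]
    · rcases Finset.mem_insert.1 he with rfl | he
      · exact ⟨ρ (Fin.last n), by simpa using congrFun hb (Fin.last n)⟩
      · exact hs e he

theorem duplicatorWins_iff {j n : ℕ} {a : Fin n → A} {b : Fin n → B} :
    DuplicatorWins πA πB j a b ↔ ¬ SpoilerWins πA πB j a b := by
  induction j generalizing n with
  | zero => simp [DuplicatorWins, SpoilerWins]
  | succ j ih => simp [DuplicatorWins, SpoilerWins, ih]

end Game

/-! ### Separating monomials yield winning strategies -/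

section Main

variable {X : Type*} [Finite X] {L : FirstOrder.Language} {A B : Type*} [Nonempty A]
  {πA : Interp L A (AbsPoly X)} {πB : Interp L B (AbsPoly X)} {Y : Finset X} {k : ℕ}

theorem snoc_comp_index {C : Type*} {n n' : ℕ} {a : Fin n → C} {a' : Fin n' → C}
    {ρ : Fin n → Fin n'} (h : a' ∘ ρ = a) (i : Fin n') :
    a' ∘ (Fin.snoc ρ i : Fin (n + 1) → Fin n') = (Fin.snoc a (a' i) : Fin (n + 1) → C) := by
  subst h
  funext x
  refine Fin.lastCases ?_ (fun x => ?_) x <;> simp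

/-- One direction suffices: negation normal form never swaps the sides, and the game is symmetric.
-/
theorem spoilerWins_of_mem_up {n r : ℕ} (φ : Formula L n) (hr : φ.qr ≤ r) (a : Fin n → A)
    (b : Fin n → B) (m : Monomial X) (hk : expSum Y m < k)
    (hA : m.topOff Y ∈ (φ.eval πA a).up) (hB : m.topOff Y ∉ (φ.eval πB b).up) :
    SpoilerWins πA πB (k * r) a b := by
  induction φ generalizing r m with
  | lit l =>
    refine .of_not_localIso fun h => hB ?_
    rw [localIso_iff] at h
    simpa only [Formula.eval, h.2 l] using hA
  | eq i j =>
    refine .of_not_localIso fun h => hB ?_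
    rw [localIso_iff] at h
    by_cases hb : b i = b j
    · simpa only [Formula.eval, (h.1 i j).2 hb, hb] using hA
    · simpa only [Formula.eval, if_neg hb, if_neg (mt (h.1 i j).1 hb)] using hA
  | ne i j =>
    refine .of_not_localIso fun h => hB ?_
    rw [localIso_iff] at h
    by_cases hb : b i = b j
    · simpa only [Formula.eval, (h.1 i j).2 hb, hb] using hA
    · simpa only [Formula.eval, if_neg hb, if_neg (mt (h.1 i j).1 hb)] using hA
  | or φ ψ ihφ ihψ =>
    have hB' := mt AbsPoly.mem_up_add.2 hB
    push Not at hB'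
    rcases AbsPoly.mem_up_add.1 hA with h | h
    · exact ihφ ((le_max_left _ _).trans hr) a b m hk h hB'.1
    · exact ihψ ((le_max_right _ _).trans hr) a b m hk h hB'.2
  | and φ ψ ihφ ihψ =>
    obtain ⟨m₁, h₁, m₂, h₂, hle⟩ := AbsPoly.mem_up_mul.1 hA
    have hYle := Monomial.le_topOff_iff.1 hle
    have hk₁ : expSum Y m₁ < k :=
      (expSum_mono fun x hx => le_self_add.trans (hYle x hx)).trans_lt hk
    have hk₂ : expSum Y m₂ < k :=
      (expSum_mono fun x hx => le_add_self.trans (hYle x hx)).trans_lt hk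
    by_cases hB₁ : m₁.topOff Y ∈ (φ.eval πB b).up
    · by_cases hB₂ : m₂.topOff Y ∈ (ψ.eval πB b).up
      · refine absurd (AbsPoly.mem_up_mul.2 ⟨_, hB₁, _, hB₂, ?_⟩) hB
        refine Monomial.le_topOff_iff.2 fun x hx => le_trans ?_ (hYle x hx)
        exact add_le_add (Monomial.absorbsOn_topOff x hx) (Monomial.absorbsOn_topOff x hx)
      · exact ihψ ((le_max_right _ _).trans hr) a b m₂ hk₂
          (AbsPoly.up_mono h₂ (Monomial.le_topOff Y m₂)) hB₂
    · exact ihφ ((le_max_left _ _).trans hr) a b m₁ hk₁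
        (AbsPoly.up_mono h₁ (Monomial.le_topOff Y m₁)) hB₁
  | ex φ ih =>
    obtain ⟨c, hc⟩ := AbsPoly.mem_up_famSum.1 hA
    have hB' := mt AbsPoly.mem_up_famSum.2 hB
    push Not at hB'
    -- Only one of the `k` turns granted to this quantifier is needed.
    have hkpos : 0 < k := by
      have := pos_of_gt hk
      exact_mod_cast this
    obtain ⟨r, rfl⟩ : ∃ r', r = r' + 1 := ⟨r - 1, by simp only [Formula.qr] at hr; omega⟩
    have hwin : SpoilerWins πA πB (k * r + 1) a b :=
      Or.inl ⟨c, fun d => ih (Nat.le_of_succ_le_succ hr) _ _ m hk hc (hB' d)⟩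
    refine hwin.mono ?_
    rw [Nat.mul_succ]
    omega
  | all φ ih =>
    obtain ⟨s, hs, hsB⟩ := exists_small_subproduct hk hB
    obtain ⟨r, rfl⟩ : ∃ r', r = r' + 1 := ⟨r - 1, by simp only [Formula.qr] at hr; omega⟩
    suffices hwin : SpoilerWins πA πB (s.card + k * r) a b from
      hwin.mono (by rw [Nat.mul_succ]; omega)
    refine .of_pick_finset s fun n' a' b' ρ ha hb hpick => ?_
    by_cases hiso : LocalIso πA πB a' b'
    swap
    · exact .of_not_localIso hiso
    classical
    -- `g d` will be an element of `A` pebbled together with `d`.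
    have hpick' : ∀ d ∈ s, ∃ c i, a' i = c ∧ b' i = d := fun d hd =>
      (hpick d hd).imp' a' fun i hi => ⟨i, rfl, hi⟩
    choose! g hg using hpick'
    -- Without repetitions, the product over the image of `s` has one factor for each `d ∈ s`, so
    -- `m` splits along `s` on the `A` side.
    have hinj : Set.InjOn g (s : Set B) := by
      intro d hd e he hde
      obtain ⟨i, hi, rfl⟩ := hg d hd
      obtain ⟨j, hj, rfl⟩ := hg e he
      exact ((localIso_iff.1 hiso).1 _ _).1 (hi.trans (hde.trans hj.symm))
    have hprod := AbsPoly.mem_up_famProd.1 hA (s.image g)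
    rw [Finset.prod_image hinj] at hprod
    obtain ⟨u, hu, hle⟩ := AbsPoly.mem_up_prod.1 hprod
    have hYle := Monomial.le_topOff_iff.1 hle
    -- If all parts were present on `B`, they would recombine to `m.topOff Y` in the small
    -- subproduct.
    have hmiss : ∃ d ∈ s, (u d).topOff Y ∉ (φ.eval πB (Fin.snoc b d)).up := by
      by_contra! hall
      refine hsB (AbsPoly.mem_up_prod.2 ⟨fun d => (u d).topOff Y, hall, ?_⟩)
      refine Monomial.le_topOff_iff.2 fun x hx => le_trans ?_ (hYle x hx)
      rw [Finset.sum_apply, Finset.sum_apply]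
      exact Finset.sum_le_sum fun d _ => Monomial.absorbsOn_topOff x hx
    obtain ⟨d, hd, hud⟩ := hmiss
    have hkd : expSum Y (u d) < k := by
      refine (expSum_mono fun x hx => le_trans ?_ (hYle x hx)).trans_lt hk
      rw [Finset.sum_apply]
      exact Finset.single_le_sum (f := fun d => u d x) (fun _ _ => zero_le) hd
    obtain ⟨i, hi, hi'⟩ := hg d hd
    have hwin := ih (Nat.le_of_succ_le_succ hr) (Fin.snoc a (g d)) (Fin.snoc b d) (u d) hkd
      (AbsPoly.up_mono (hu d hd) (Monomial.le_topOff Y _)) hud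
    -- The pair `(g d, d)` is already pebbled at position `i`, so instantiating the quantifier costs
    -- no further turn; all other new pebbles are forgotten.
    refine .of_comp (Fin.snoc ρ i : Fin _ → Fin n') ?_
    rw [snoc_comp_index ha, snoc_comp_index hb, hi, hi']
    exact hwin

theorem YSeparates.spoilerWins [Nonempty B] {n r : ℕ} {φ : Formula L n} (hr : φ.qr ≤ r)
    {a : Fin n → A} {b : Fin n → B} {m : Monomial X}
    (h : YSeparates Y m (φ.eval πA a) (φ.eval πB b)) (hk : expSum Y m < k) :
    SpoilerWins πA πB (k * r) a b := by
  rcases h with ⟨hm, hn⟩ | ⟨hm, hn⟩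
  · refine spoilerWins_of_mem_up φ hr a b m hk
      (Monomial.mem_up_topOff.2 ⟨m, hm, fun _ _ => le_rfl⟩) fun h => ?_
    obtain ⟨m', h₁, h₂⟩ := Monomial.mem_up_topOff.1 h
    exact hn m' h₁ h₂
  · refine (spoilerWins_of_mem_up φ hr b a m hk
      (Monomial.mem_up_topOff.2 ⟨m, hm, fun _ _ => le_rfl⟩) fun h => ?_).symm
    obtain ⟨m', h₁, h₂⟩ := Monomial.mem_up_topOff.1 h
    exact hn m' h₁ h₂

/-- Polynomials that differ are separated on a set of indeterminates with finite exponents. -/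
theorem exists_ySeparates {p q : AbsPoly X} (h : p ≠ q) :
    ∃ (Y : Finset X) (m : Monomial X), YSeparates Y m p q ∧ expSum Y m < ⊤ := by
  classical
  have key : ∀ p q : AbsPoly X, ¬ p ≤ q →
      ∃ (Y : Finset X) (m : Monomial X), YSeparates Y m p q ∧ expSum Y m < ⊤ := by
    intro p q h
    have h' : ¬ ∀ m ∈ p.monomials, ∃ m' ∈ q.monomials, Absorbs m' m := h
    push Not at h'
    obtain ⟨m, hm, hn⟩ := h'
    have := Fintype.ofFinite X
    -- Where `m` has exponent `∞` absorption is automatic, so `Y` may omit these indeterminates,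
    -- which keeps the weight finite.
    refine ⟨Finset.univ.filter fun x => m x ≠ ⊤, m, Or.inl ⟨hm, fun m' hm' hY => ?_⟩, ?_⟩
    · refine hn m' hm' fun x => ?_
      by_cases hx : m x = ⊤
      · rw [hx]
        exact le_top
      · exact hY x (by simpa using hx)
    · exact WithTop.sum_lt_top.2 fun x hx => lt_top_iff_ne_top.2 (Finset.mem_filter.1 hx).2
  by_cases hpq : p ≤ q
  · obtain ⟨Y, m, h₁, h₂⟩ := key q p fun hqp => h (le_antisymm hpq hqp)
    exact ⟨Y, m, h₁.symm, h₂⟩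
  · exact key p q hpq

end Main

end SemiringEF

theorem mainTheorem9 {X : Type*} [Finite X] {L : FirstOrder.Language} [L.IsRelational]
    {A B : Type*} [Nonempty A] [Nonempty B]
    (πA : SemiringEF.Interp L A (SemiringEF.AbsPoly X))
    (πB : SemiringEF.Interp L B (SemiringEF.AbsPoly X))
    {n : ℕ} (a : Fin n → A) (b : Fin n → B) :
    (∀ k : ℕ, 1 ≤ k → ∀ (r : ℕ) (φ : SemiringEF.Formula L n),
      φ.eval πA a ≠ φ.eval πB b → φ.qr ≤ r →
      ∀ (Y : Finset X) (m : SemiringEF.Monomial X),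
        SemiringEF.YSeparates Y m (φ.eval πA a) (φ.eval πB b) →
        SemiringEF.expSum Y m < (k : ℕ∞) →
        SemiringEF.SpoilerWins πA πB (k * r) a b) ∧
    (SemiringEF.DuplicatorWinsG πA πB a b → SemiringEF.ElemEquiv πA πB a b) := by
  refine ⟨fun k _ r φ _ hr Y m hsep hk => hsep.spoilerWins hr hk, fun hdup φ => ?_⟩
  by_contra hne
  obtain ⟨Y, m, hsep, hfin⟩ := SemiringEF.exists_ySeparates hne
  obtain ⟨e, he⟩ := ENat.ne_top_iff_exists.1 hfin.ne
  have hk : SemiringEF.expSum Y m < ((e + 1 : ℕ) : ℕ∞) := by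
    rw [← he]
    exact_mod_cast Nat.lt_succ_self e
  exact SemiringEF.duplicatorWins_iff.1 (hdup _) (hsep.spoilerWins le_rfl hk)
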